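/- A $3$-Schur overpartition of a nonnegative integer $m$ is a partition of $m$ into odd parts not divisible by $3$ in which the first occurrence of each distinct part may or may not be overlined; let $\overline{S}_3(m)$ denote the number of them, so that $$\sum_{m\ge 0}\overline{S}_3(m)q^m=\prod_{k\ge 1}\frac{(1+q^{2k-1})(1-q^{3(2k-1)})}{(1+q^{3(2k-1)})(1-q^{2k-1})}.$$ Let $p\ge 5$ be a prime with Legendre symbol $\left(\frac{-6}{p}\right)=-1$, and let $i$ be an integer with $1\le i\le p-1$. Then for all integers $\alpha\ge 0$ and $n\ge 0$, $$\overline{S}_3\bigl(48p^{2\alpha+2}n+2(24i+5p)p^{2\alpha+1}\bigr)\equiv 0 \pmod{24}.$$ -/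

import Mathlib

/-- The set `I(t) = {1, 3, 5, …, 2t - 1} \ {t}` of residues modulo `2t` (for odd `t ≥ 3`). -/
def schurResidues (t : ℕ) : Finset ℕ :=
  ((Finset.range (2 * t)).filter (fun i => Odd i)).erase t

/-- The `t`-Schur overpartitions of `n`: a partition of `n` all of whose parts are congruent
modulo `2t` to an element of `I(t)`, together with the set of those distinct part sizes whose
first occurrence is overlined. -/
def schurOverpartitions (t n : ℕ) : Finset (Σ _ : n.Partition, Finset ℕ) :=
  (Finset.univ.filter
      (fun π : n.Partition => ∀ a ∈ π.parts, a % (2 * t) ∈ schurResidues t)).sigma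
    (fun π => π.parts.toFinset.powerset)

/-- The number of `t`-Schur overpartitions of `n`. -/
def schurOverpartitionCount (t n : ℕ) : ℕ :=
  (schurOverpartitions t n).card

/-!
Let `S` be the generating function of the `3`-Schur overpartitions and let
`θ(q) = φ(-q) = ∑ (-1) ^ n * q ^ (n ^ 2)`. Gauss' product formula for `θ` turns the product
formula for `S` into `S(q) * θ(q) * θ(q ^ 6) = θ(q ^ 2) * θ(q ^ 3)`.

Modulo `8`, writing each theta function as `1 + 2 * a` expresses the `N`-th coefficient of `S`
through the representations of `N` by forms `k * x ^ 2` and `i * x ^ 2 + j * y ^ 2`. When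
`N % 48 = 10`, all of these but `x ^ 2 + 6 * y ^ 2` are excluded by congruences modulo `16` or
`3`. This last form is excluded because `-6` is a nonresidue modulo `p` and the exponent of `p`
in `N` is odd.

Modulo `3`, cubing is the substitution of `q ^ 3` for `q`, so that `S(q) * θ(q ^ 2) ^ 2 = θ(q) ^ 2`.
As `φ(q) * θ(q) = θ(q ^ 2) ^ 2`, three successive `2`-dissections show that the series `F` with
coefficients `S (8 * n + 2)` satisfies `F * θ ^ 8 = 8 * φ ^ 6 * ψ ^ 2`. Since `ψ ^ 2 * θ` is the
cube of an Euler product, both `θ ^ 9` and `F * θ ^ 9` are cubes, so `F` is a series in `q ^ 3`.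
-/
section PowerSeriesOperators

open PowerSeries Finset

variable {R : Type*} [CommRing R]

theorem expand_injective {k : ℕ} (hk : k ≠ 0) :
    Function.Injective (expand k hk : R⟦X⟧ →ₐ[R] R⟦X⟧) := by
  intro f g h
  ext n
  rw [← coeff_expand_mul k hk f, h, coeff_expand_mul]

theorem evalNegHom_evalNegHom (f : R⟦X⟧) : evalNegHom (evalNegHom f) = f := by
  simp [evalNegHom, rescale_rescale]

theorem evalNegHom_expand {k : ℕ} (hk : k ≠ 0) (heven : Even k) (f : R⟦X⟧) :
    evalNegHom (f.expand k hk) = f.expand k hk := by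
  ext n
  rw [evalNegHom, coeff_rescale, coeff_expand]
  split_ifs with h
  · rw [(heven.trans_dvd h).neg_one_pow, one_mul]
  · rw [mul_zero]

theorem expand_four (f : R⟦X⟧) :
    f.expand 4 four_ne_zero = (f.expand 2 two_ne_zero).expand 2 two_ne_zero :=
  expand_mul 2 two_ne_zero 2 two_ne_zero f

theorem expand_six (f : R⟦X⟧) :
    f.expand 6 (by norm_num) = (f.expand 2 two_ne_zero).expand 3 three_ne_zero :=
  expand_mul 3 three_ne_zero 2 two_ne_zero f

theorem expand_eight (f : R⟦X⟧) :
    f.expand 8 (by norm_num) = (f.expand 2 two_ne_zero).expand 4 four_ne_zero :=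
  expand_mul 4 four_ne_zero 2 two_ne_zero f

theorem eq_of_sq_mul_expand_eq [IsDomain R] (h2 : (2 : R) ≠ 0) {f g : R⟦X⟧}
    (hf : constantCoeff f = 1) (hg : constantCoeff g = 1)
    (h : f ^ 2 * g.expand 2 two_ne_zero = g ^ 2 * f.expand 2 two_ne_zero) : f = g := by
  have horder {u : R⟦X⟧} (hu : constantCoeff u ≠ 0) : u.order = 0 :=
    of_not_not (mt order_ne_zero_iff_constCoeff_eq_zero.1 hu)
  have hsum : (f + g).order = 0 := horder (by rwa [map_add, hf, hg, one_add_one_eq_two])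
  have hg' : g.order = 0 := horder (by rw [hg]; exact one_ne_zero)
  have hdiff : (f - g).order ≠ 0 :=
    order_ne_zero_iff_constCoeff_eq_zero.2 (by rw [map_sub, hf, hg, sub_self])
  have hmul : (f - g) * ((f + g) * g.expand 2 two_ne_zero) =
      g ^ 2 * (f - g).expand 2 two_ne_zero := by
    rw [map_sub]
    linear_combination h
  -- Expansion doubles the order, so the order `d` of `f - g` satisfies `d = 2 * d`.
  have hdouble := congrArg order hmul
  simp only [order_mul, order_pow, order_expand, hsum, hg', smul_zero, add_zero, zero_add]
    at hdouble
  rw [← sub_eq_zero, ← order_eq_top]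
  cases hd : (f - g).order with
  | top => rfl
  | coe d =>
    rw [hd, nsmul_eq_mul] at hdouble
    rw [hd] at hdiff
    norm_cast at hdouble hdiff
    omega

/-- The `r`-th component of the `m`-dissection of a power series: `∑ a (m * n + r) * X ^ n` is
extracted from `∑ a n * X ^ n`. -/
noncomputable def dissect (m r : ℕ) : R⟦X⟧ →ₗ[R] R⟦X⟧ where
  toFun f := mk fun n ↦ coeff (m * n + r) f
  map_add' f g := by ext n; simp
  map_smul' c f := by ext n; simp

theorem coeff_dissect (m r : ℕ) (f : R⟦X⟧) (n : ℕ) :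
    coeff n (dissect m r f) = coeff (m * n + r) f := by
  simp [dissect]

theorem dissect_dissect (k s m r : ℕ) (f : R⟦X⟧) :
    dissect m r (dissect k s f) = dissect (k * m) (k * r + s) f := by
  ext n
  simp only [coeff_dissect]
  congr 2
  ring

theorem dissect_zero_expand {m k : ℕ} (hk : k ≠ 0) (h : k.Coprime m)
    (f : R⟦X⟧) : dissect m 0 (f.expand k hk) = (dissect m 0 f).expand k hk := by
  ext n
  simp only [coeff_dissect, coeff_expand, add_zero, h.dvd_mul_left]
  split_ifs with hd
  · rw [Nat.mul_div_assoc m hd]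
  · rfl

theorem dissect_mul_expand {m r : ℕ} (hm : m ≠ 0) (hr : r < m) (f g : R⟦X⟧) :
    dissect m r (f * g.expand m hm) = dissect m r f * g := by
  ext n
  rw [coeff_dissect, coeff_mul, coeff_mul]
  refine (sum_of_injOn (fun ab ↦ (m * ab.1 + r, m * ab.2)) ?_ ?_ ?_ ?_).symm
  · rintro ⟨a, b⟩ - ⟨a', b'⟩ - h
    simpa [hm] using h
  · rintro ⟨a, b⟩ hab
    simp only [mem_coe, HasAntidiagonal.mem_antidiagonal] at hab ⊢
    rw [← hab]
    ring
  · rintro ⟨a, b⟩ hab hnot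
    rw [coeff_expand_of_not_dvd, mul_zero]
    rintro ⟨c, rfl⟩
    rw [HasAntidiagonal.mem_antidiagonal] at hab
    have hc : c ≤ n := Nat.lt_succ_iff.1 <| lt_of_mul_lt_mul_left (a := m) (by grind) m.zero_le
    obtain ⟨d, rfl⟩ := Nat.exists_eq_add_of_le' hc
    exact hnot ⟨(d, c), by simp, by grind⟩
  · rintro ⟨a, b⟩ -
    rw [coeff_dissect, coeff_expand_mul]

theorem dissect_X_pow {m r s : ℕ} (hs : s < m) :
    dissect m r (X ^ s : R⟦X⟧) = if r = s then 1 else 0 := by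
  ext n
  have hn : m * n + r = s ↔ n = 0 ∧ r = s := by
    refine ⟨fun h ↦ ?_, fun h ↦ by simp [h]⟩
    obtain rfl : n = 0 := by
      by_contra hn
      nlinarith [Nat.pos_of_ne_zero hn]
    simpa using h
  rw [coeff_dissect, coeff_X_pow, if_congr hn rfl rfl, apply_ite (coeff n), coeff_one, map_zero]
  split_ifs <;> tauto

theorem dissect_two_zero (f g : R⟦X⟧) :
    dissect 2 0 (f.expand 2 two_ne_zero + X * g.expand 2 two_ne_zero) = f := by
  have h1 := dissect_X_pow (R := R) (r := 0) (s := 0) two_pos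
  have hX := dissect_X_pow (R := R) (r := 0) (s := 1) one_lt_two
  simp only [pow_zero, pow_one, if_true, zero_ne_one, if_false] at h1 hX
  rw [map_add, ← one_mul (expand _ _ f), dissect_mul_expand _ two_pos,
    dissect_mul_expand _ two_pos, h1, hX, one_mul, zero_mul, add_zero]

theorem dissect_two_one (f g : R⟦X⟧) :
    dissect 2 1 (f.expand 2 two_ne_zero + X * g.expand 2 two_ne_zero) = g := by
  have h1 := dissect_X_pow (R := R) (r := 1) (s := 0) two_pos
  have hX := dissect_X_pow (R := R) (r := 1) (s := 1) one_lt_two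
  simp only [pow_zero, pow_one, if_true, one_ne_zero, if_false] at h1 hX
  rw [map_add, ← one_mul (expand _ _ f), dissect_mul_expand _ one_lt_two,
    dissect_mul_expand _ one_lt_two, h1, hX, one_mul, zero_mul, zero_add]

theorem coeff_eq_zero_of_mul_expand_eq_expand [IsDomain R] {k : ℕ} (hk : k ≠ 0) {f g h : R⟦X⟧}
    (hg : g ≠ 0) (hfg : f * g.expand k hk = h.expand k hk) {n : ℕ} (hn : ¬ k ∣ n) :
    coeff n f = 0 := by
  have hr : n % k < k := Nat.mod_lt n (Nat.pos_of_ne_zero hk)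
  have hone : dissect k (n % k) (1 : R⟦X⟧) = 0 := by
    rw [← pow_zero X, dissect_X_pow (Nat.pos_of_ne_zero hk), if_neg (mt Nat.dvd_of_mod_eq_zero hn)]
  have hdissect : dissect k (n % k) f = 0 := by
    refine (mul_eq_zero.1 ?_).resolve_right hg
    rw [← dissect_mul_expand hk hr, hfg, ← one_mul (h.expand k hk), dissect_mul_expand hk hr,
      hone, zero_mul]
  rw [← Nat.div_add_mod n k, ← coeff_dissect, hdissect, map_zero]

theorem pow_eq_expand (p : ℕ) [Fact p.Prime] (f : (ZMod p)⟦X⟧) :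
    f ^ p = f.expand p (NeZero.ne p) := by
  have h := MvPowerSeries.map_frobenius_expand p (NeZero.ne p) (f := f)
  rw [ZMod.frobenius_zmod, MvPowerSeries.map_id] at h
  exact h.symm

end PowerSeriesOperators

section Topology

open PowerSeries Filter
open scoped PowerSeries.WithPiTopology Topology

variable {R : Type*} [CommRing R] [TopologicalSpace R]

theorem continuous_of_continuous_coeff {F : R⟦X⟧ → R⟦X⟧}
    (hF : ∀ d, Continuous fun f ↦ coeff d (F f)) : Continuous F := by
  refine continuous_iff_continuousAt.2 fun f ↦ ?_
  exact (WithPiTopology.tendsto_iff_coeff_tendsto ..).2 fun d ↦ (hF d).continuousAt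

theorem continuous_expand {k : ℕ} (hk : k ≠ 0) :
    Continuous (expand k hk : R⟦X⟧ →ₐ[R] R⟦X⟧) := by
  refine continuous_of_continuous_coeff fun d ↦ ?_
  simp only [coeff_expand]
  split_ifs
  · exact WithPiTopology.continuous_coeff R _
  · exact continuous_const

theorem continuous_evalNegHom [ContinuousMul R] : Continuous (evalNegHom : R⟦X⟧ →+* R⟦X⟧) := by
  refine continuous_of_continuous_coeff fun d ↦ ?_
  simp only [evalNegHom, coeff_rescale]
  exact (WithPiTopology.continuous_coeff R d).const_mul _

theorem tendsto_zero_of_X_pow_dvd {f : ℕ → R⟦X⟧} (h : ∀ n, X ^ n ∣ f n) :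
    Tendsto f atTop (𝓝 0) := by
  refine (WithPiTopology.tendsto_iff_coeff_tendsto ..).2 fun d ↦ ?_
  exact tendsto_atTop_of_eventually_const (i₀ := d + 1) fun n hn ↦
    X_pow_dvd_iff.1 (h n) d hn

end Topology

section Shanks

open Finset

variable {R : Type*} [CommRing R]

/-- The `s`-th summand of Shanks' finite form of Gauss' theta function identity, in which the
Euler product is cut off after `n` factors. -/
def shanksTerm (q : R) (n s : ℕ) : R :=
  (-1) ^ s * (∏ k ∈ Ico s n, (1 - q ^ (k + 1))) * (∏ k ∈ range s, (1 + q ^ k)) * q ^ (s * (n + 1))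

theorem shanksTerm_zero (q : R) (n : ℕ) :
    shanksTerm q n 0 = ∏ k ∈ range n, (1 - q ^ (k + 1)) := by
  simp [shanksTerm]

theorem shanksTerm_self (q : R) (n : ℕ) :
    shanksTerm q n n = (-1) ^ n * (∏ k ∈ range n, (1 + q ^ k)) * q ^ (n * (n + 1)) := by
  rw [shanksTerm, Ico_self, prod_empty, mul_one]

theorem sum_shanksTerm_succ (q : R) {n j : ℕ} (hj : j ≤ n) :
    ∑ s ∈ range (j + 1), shanksTerm q (n + 1) s =
      (1 + q ^ (n + 1)) * ∑ s ∈ range (j + 1), shanksTerm q n s +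
        (-1) ^ (j + 1) * (∏ k ∈ Ico j n, (1 - q ^ (k + 1))) *
          (∏ k ∈ range (j + 1), (1 + q ^ k)) * q ^ ((j + 1) * (n + 1)) := by
  induction j with
  | zero =>
    simp only [shanksTerm, zero_add, sum_range_one, prod_range_one, prod_range_zero]
    rw [prod_Ico_succ_top n.zero_le]
    ring
  | succ j ih =>
    rw [sum_range_succ, ih (by omega), sum_range_succ _ (j + 1), shanksTerm, shanksTerm,
      prod_Ico_succ_top hj, prod_eq_prod_Ico_succ_bot (by omega : j < n),
      prod_range_succ _ (j + 1)]
    ring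

theorem prod_mul_one_add_two_mul_sum (q : R) (n : ℕ) :
    (∏ k ∈ range n, (1 + q ^ (k + 1))) *
        (1 + 2 * ∑ s ∈ range n, (-1) ^ (s + 1) * q ^ ((s + 1) ^ 2)) =
      ∑ s ∈ range (n + 1), shanksTerm q n s := by
  induction n with
  | zero => simp [shanksTerm]
  | succ n ih =>
    have hprod : ∏ k ∈ range (n + 1), (1 + q ^ k) = 2 * ∏ k ∈ range n, (1 + q ^ (k + 1)) := by
      rw [prod_range_succ', pow_zero, one_add_one_eq_two, mul_comm]
    rw [sum_range_succ _ (n + 1), sum_shanksTerm_succ q le_rfl, shanksTerm_self, ← ih,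
      prod_range_succ _ n, sum_range_succ _ n, hprod, Ico_self, prod_empty]
    ring

theorem pow_dvd_sum_shanksTerm (q : R) (n : ℕ) :
    q ^ n ∣ ∑ s ∈ range n, shanksTerm q n (s + 1) :=
  dvd_sum fun s _ ↦ Dvd.dvd.mul_left (pow_dvd_pow q (by nlinarith)) _

end Shanks

section Theta

open PowerSeries Finset Filter
open scoped PowerSeries.WithPiTopology Topology

/-- The generating function of the positive squares. -/
noncomputable def squareSeries : ℤ⟦X⟧ :=
  mk fun n ↦ if n ≠ 0 ∧ IsSquare n then 1 else 0

/-- Ramanujan's theta function `φ(q) = ∑ q ^ (n ^ 2)`, summed over the integers `n`. -/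
noncomputable def thetaPhi : ℤ⟦X⟧ := 1 + 2 * squareSeries

/-- Ramanujan's theta function at `-q`: the series `φ(-q) = ∑ (-1) ^ n * q ^ (n ^ 2)`. -/
noncomputable def thetaPhiNeg : ℤ⟦X⟧ := evalNegHom thetaPhi

/-- Ramanujan's theta function `ψ(q) = ∑ q ^ (n * (n + 1) / 2)`, summed over the natural
numbers `n`. The triangular numbers are recognised by
`8 * (n * (n + 1) / 2) + 1 = (2 * n + 1) ^ 2`. -/
noncomputable def thetaPsi : ℤ⟦X⟧ :=
  mk fun n ↦ if IsSquare (8 * n + 1) then 1 else 0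

theorem coeff_squareSeries (n : ℕ) :
    coeff n squareSeries = if n ≠ 0 ∧ IsSquare n then 1 else 0 :=
  coeff_mk _ _

theorem constantCoeff_thetaPhi : constantCoeff thetaPhi = 1 := by
  have h : constantCoeff squareSeries = 0 := by
    rw [← coeff_zero_eq_constantCoeff_apply, coeff_squareSeries, if_neg (by simp)]
  rw [thetaPhi, map_add, map_one, map_mul, h, mul_zero, add_zero]

theorem constantCoeff_thetaPhiNeg : constantCoeff thetaPhiNeg = 1 := by
  rw [← coeff_zero_eq_constantCoeff_apply, thetaPhiNeg, evalNegHom, coeff_rescale, pow_zero,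
    one_mul, coeff_zero_eq_constantCoeff_apply, constantCoeff_thetaPhi]

theorem constantCoeff_thetaPsi : constantCoeff thetaPsi = 1 := by
  rw [← coeff_zero_eq_constantCoeff_apply, thetaPsi, coeff_mk, if_pos (by simp)]

theorem hasSum_squareSeries : HasSum (fun s : ℕ ↦ (X ^ (s + 1) ^ 2 : ℤ⟦X⟧)) squareSeries := by
  rw [WithPiTopology.hasSum_iff_hasSum_coeff]
  intro d
  simp only [coeff_X_pow, coeff_squareSeries]
  split_ifs with hd
  · obtain ⟨hd0, r, rfl⟩ := hd
    obtain ⟨s, rfl⟩ := Nat.exists_eq_succ_of_ne_zero (left_ne_zero_of_mul hd0)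
    refine (hasSum_ite_eq s (1 : ℤ)).congr_fun fun t ↦ ?_
    refine if_congr ?_ rfl rfl
    rw [← sq, (Nat.pow_left_injective two_ne_zero).eq_iff, Nat.succ_inj, eq_comm]
  · refine hasSum_zero.congr_fun fun s ↦ if_neg ?_
    rintro rfl
    exact hd ⟨by positivity, IsSquare.sq _⟩

theorem hasSum_evalNegHom_squareSeries :
    HasSum (fun s : ℕ ↦ (-1) ^ (s + 1) * (X ^ (s + 1) ^ 2 : ℤ⟦X⟧)) (evalNegHom squareSeries) := by
  refine (hasSum_squareSeries.map _ continuous_evalNegHom).congr_fun fun s ↦ ?_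
  rw [Function.comp_apply, map_pow, evalNegHom_X]
  rcases Nat.even_or_odd (s + 1) with h | h
  · rw [h.neg_one_pow, one_mul, (h.pow_of_ne_zero two_ne_zero).neg_pow]
  · rw [h.neg_one_pow, neg_one_mul, h.pow.neg_pow]

/-- The Euler product `∏ (1 - q ^ k)` restricted to the odd exponents `k`. -/
noncomputable def oddEuler : ℤ⟦X⟧ := ∏' k, (1 - X ^ (2 * k + 1))

theorem hasProd_oddEuler : HasProd (fun k ↦ (1 - X ^ (2 * k + 1) : ℤ⟦X⟧)) oddEuler := by
  refine Multipliable.hasProd ?_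
  simp only [sub_eq_add_neg]
  refine WithPiTopology.multipliable_one_add_of_tendsto_order_atTop_nhds_top _
    (f := fun k : ℕ ↦ -X ^ (2 * k + 1)) ?_
  simp only [order_neg, order_X_pow]
  exact ENat.tendsto_natCast_nhds_top.comp
    (tendsto_atTop_mono (fun k : ℕ ↦ (by omega : k ≤ 2 * k + 1)) tendsto_id)

theorem pentagonalSeries_ne_zero : pentagonalSeries ℤ ≠ 0 := by
  rw [← WithPiTopology.tprod_one_sub_X_pow]
  exact WithPiTopology.tprod_one_sub_X_pow_ne_zero ℤ

theorem pentagonalSeries_eq_oddEuler_mul :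
    pentagonalSeries ℤ = oddEuler * (pentagonalSeries ℤ).expand 2 two_ne_zero := by
  have heven := (WithPiTopology.hasProd_one_sub_X_pow ℤ).map _ (continuous_expand two_ne_zero)
  simp only [Function.comp_def, map_sub, map_one, map_pow, expand_X, ← pow_mul] at heven
  have h := hasProd_oddEuler.even_mul_odd (f := fun k ↦ (1 - X ^ (k + 1) : ℤ⟦X⟧)) heven
  exact (WithPiTopology.hasProd_one_sub_X_pow ℤ).unique h

theorem thetaPhiNeg_mul_pentagonalSeries :
    thetaPhiNeg * (pentagonalSeries ℤ).expand 2 two_ne_zero = pentagonalSeries ℤ ^ 2 := by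
  have hE := (WithPiTopology.hasProd_one_sub_X_pow ℤ).tendsto_prod_nat
  have hE₂ := ((WithPiTopology.hasProd_one_sub_X_pow ℤ).map _
    (continuous_expand two_ne_zero)).tendsto_prod_nat
  have hθ := (hasSum_evalNegHom_squareSeries.tendsto_sum_nat.const_mul 2).const_add 1
  have hrest := tendsto_zero_of_X_pow_dvd (pow_dvd_sum_shanksTerm (X : ℤ⟦X⟧))
  have hlim := hE.mul (hE.add hrest)
  rw [add_zero, ← sq] at hlim
  rw [thetaPhiNeg, thetaPhi, map_add, map_mul, map_one, map_ofNat]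
  refine tendsto_nhds_unique (hθ.mul hE₂) (hlim.congr fun n ↦ ?_)
  have hsum := (prod_mul_one_add_two_mul_sum (X : ℤ⟦X⟧) n).trans (sum_range_succ' _ n)
  rw [shanksTerm_zero] at hsum
  have hprod : ∏ k ∈ range n, expand 2 two_ne_zero (1 - (X : ℤ⟦X⟧) ^ (k + 1)) =
      (∏ k ∈ range n, (1 - X ^ (k + 1))) * ∏ k ∈ range n, (1 + X ^ (k + 1)) := by
    rw [← prod_mul_distrib]
    refine prod_congr rfl fun k _ ↦ ?_
    rw [map_sub, map_one, map_pow, expand_X]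
    ring
  simp only [Function.comp_apply, hprod]
  linear_combination -(∏ k ∈ range n, (1 - (X : ℤ⟦X⟧) ^ (k + 1))) * hsum

theorem thetaPhiNeg_eq_oddEuler_sq_mul : thetaPhiNeg =
    oddEuler ^ 2 * (pentagonalSeries ℤ).expand 2 two_ne_zero := by
  have hne : (pentagonalSeries ℤ).expand 2 two_ne_zero ≠ 0 :=
    (map_ne_zero_iff _ (expand_injective two_ne_zero)).2 pentagonalSeries_ne_zero
  refine mul_right_cancel₀ hne ?_
  rw [thetaPhiNeg_mul_pentagonalSeries]
  nth_rw 1 [pentagonalSeries_eq_oddEuler_mul]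
  ring

theorem hasProd_evalNegHom_oddEuler :
    HasProd (fun k ↦ (1 + X ^ (2 * k + 1) : ℤ⟦X⟧)) (evalNegHom oddEuler) := by
  refine (hasProd_oddEuler.map _ continuous_evalNegHom).congr_fun fun k ↦ ?_
  rw [Function.comp_apply, map_sub, map_one, map_pow, evalNegHom_X,
    (odd_two_mul_add_one k).neg_pow, sub_neg_eq_add]

theorem oddEuler_mul_evalNegHom_oddEuler :
    oddEuler * evalNegHom oddEuler = oddEuler.expand 2 two_ne_zero := by
  have hexpand := hasProd_oddEuler.map _ (continuous_expand two_ne_zero)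
  refine (hasProd_oddEuler.mul hasProd_evalNegHom_oddEuler).unique (hexpand.congr_fun fun k ↦ ?_)
  rw [Function.comp_apply, map_sub, map_one, map_pow, expand_X]
  ring

theorem expand_two_thetaPhiNeg_eq : thetaPhiNeg.expand 2 two_ne_zero =
    oddEuler * evalNegHom oddEuler * (pentagonalSeries ℤ).expand 2 two_ne_zero := by
  rw [thetaPhiNeg_eq_oddEuler_sq_mul, map_mul, map_pow, sq, mul_assoc, ← map_mul,
    ← pentagonalSeries_eq_oddEuler_mul, oddEuler_mul_evalNegHom_oddEuler]

theorem evalNegHom_thetaPhiNeg : evalNegHom thetaPhiNeg = thetaPhi :=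
  evalNegHom_evalNegHom _

theorem thetaPhi_mul_thetaPhiNeg :
    thetaPhi * thetaPhiNeg = thetaPhiNeg.expand 2 two_ne_zero ^ 2 := by
  rw [← evalNegHom_thetaPhiNeg, expand_two_thetaPhiNeg_eq, thetaPhiNeg_eq_oddEuler_sq_mul,
    map_mul, map_pow, evalNegHom_expand two_ne_zero even_two]
  ring

end Theta

section SchurSeries

open PowerSeries Finset
open scoped PowerSeries.WithPiTopology

/-- The generating function of the `3`-Schur overpartitions. -/
def schurSeries : ℤ⟦X⟧ :=
  mk fun n ↦ (schurOverpartitionCount 3 n : ℤ)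

theorem schurSeries_eq_genFun : schurSeries =
    Nat.Partition.genFun fun i _ ↦ if i % 6 ∈ schurResidues 3 then (2 : ℤ) else 0 := by
  ext n
  rw [schurSeries, coeff_mk, Nat.Partition.coeff_genFun, schurOverpartitionCount,
    schurOverpartitions, card_sigma, sum_filter]
  push_cast
  refine sum_congr rfl fun π _ ↦ ?_
  rw [Finsupp.prod, Multiset.toFinsupp_support]
  split_ifs with h
  · rw [prod_congr rfl fun i hi ↦ if_pos (h i (Multiset.mem_toFinset.1 hi)), prod_const,
      card_powerset, Nat.cast_pow, Nat.cast_ofNat]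
  · push Not at h
    obtain ⟨a, ha, ha'⟩ := h
    exact (prod_eq_zero (Multiset.mem_toFinset.2 ha) (if_neg ha')).symm

theorem one_add_tsum_two_smul_mul {i : ℕ} (hi : i ≠ 0) :
    (1 + ∑' j, (2 : ℤ) • (X : ℤ⟦X⟧) ^ (i * (j + 1))) * (1 - X ^ i) = 1 + X ^ i := by
  have hconst : constantCoeff ((X : ℤ⟦X⟧) ^ i) = 0 := by simp [hi]
  have hgeom := WithPiTopology.tsum_pow_mul_one_sub_of_constantCoeff_eq_zero hconst
  have hs := WithPiTopology.summable_pow_of_constantCoeff_eq_zero hconst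
  have htail : ∑' j, (2 : ℤ) • (X : ℤ⟦X⟧) ^ (i * (j + 1)) = 2 * (X ^ i * ∑' j, (X ^ i) ^ j) := by
    rw [← hs.tsum_mul_left, ← (hs.mul_left _).tsum_mul_left]
    refine tsum_congr fun j ↦ ?_
    rw [pow_mul, pow_succ', zsmul_eq_mul, Int.cast_ofNat]
  rw [htail]
  linear_combination (2 * X ^ i) * hgeom

theorem hasProd_schurSeries : HasProd (fun k ↦ if 3 ∣ 2 * k + 1 then 1 else
    (1 + ∑' j, (2 : ℤ) • (X : ℤ⟦X⟧) ^ ((2 * k + 1) * (j + 1)))) schurSeries := by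
  have hI : schurResidues 3 = {1, 5} := by decide
  have hG := Nat.Partition.hasProd_genFun fun i _ ↦ if i % 6 ∈ schurResidues 3 then (2 : ℤ) else 0
  rw [← schurSeries_eq_genFun, ← (mul_right_injective₀ (two_ne_zero (α := ℕ))).hasProd_iff] at hG
  · refine hG.congr_fun fun k ↦ ?_
    have hmod : (2 * k + 1) % 6 ∈ schurResidues 3 ↔ ¬ 3 ∣ 2 * k + 1 := by
      rw [hI, mem_insert, mem_singleton]
      omega
    split_ifs with hk
    · simp [hmod, hk, smul_eq_C_mul]
    · simp only [Function.comp_apply, hmod, hk, not_false_eq_true, if_true]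
      rfl
  · intro k hk
    have hodd : k % 2 = 1 := by
      by_contra h
      exact hk ⟨k / 2, by simp only; omega⟩
    have hmod : (k + 1) % 6 ∉ schurResidues 3 := by
      rw [hI, mem_insert, mem_singleton]
      omega
    simp [hmod, smul_eq_C_mul]

theorem hasProd_ite_three_dvd {R : Type*} [CommRing R] [TopologicalSpace R] {f : ℕ → R⟦X⟧}
    {P : R⟦X⟧} (hf : HasProd f P) (hexpand : ∀ k, f (3 * k + 1) = (f k).expand 3 three_ne_zero) :
    HasProd (fun k ↦ if 3 ∣ 2 * k + 1 then f k else 1) (P.expand 3 three_ne_zero) := by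
  have hinj : Function.Injective fun k ↦ 3 * k + 1 := fun a b h ↦ by simpa using h
  rw [← hinj.hasProd_iff]
  · refine (hf.map _ (continuous_expand three_ne_zero)).congr_fun fun k ↦ ?_
    rw [Function.comp_apply, if_pos ⟨2 * k + 1, by ring⟩, hexpand, Function.comp_apply]
  · intro k hk
    refine if_neg fun h ↦ hk ⟨k / 3, ?_⟩
    simp only
    omega

theorem schurSeries_mul_oddEuler :
    schurSeries * oddEuler * (evalNegHom oddEuler).expand 3 three_ne_zero =
      evalNegHom oddEuler * oddEuler.expand 3 three_ne_zero := by
  have hO := hasProd_ite_three_dvd hasProd_oddEuler fun k ↦ by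
    rw [map_sub, map_one, map_pow, expand_X]
    ring
  have hN := hasProd_ite_three_dvd hasProd_evalNegHom_oddEuler fun k ↦ by
    rw [map_add, map_one, map_pow, expand_X]
    ring
  refine ((hasProd_schurSeries.mul hasProd_oddEuler).mul hN).unique
    ((hasProd_evalNegHom_oddEuler.mul hO).congr_fun fun k ↦ ?_)
  split_ifs
  · ring
  · rw [one_add_tsum_two_smul_mul (Nat.succ_ne_zero _)]

theorem schurSeries_mul_thetaPhiNeg :
    schurSeries * thetaPhiNeg * thetaPhiNeg.expand 6 (by norm_num) =
      thetaPhiNeg.expand 2 two_ne_zero * thetaPhiNeg.expand 3 three_ne_zero := by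
  rw [expand_six, expand_two_thetaPhiNeg_eq, thetaPhiNeg_eq_oddEuler_sq_mul]
  simp only [map_mul, map_pow]
  set E := (pentagonalSeries ℤ).expand 2 two_ne_zero
  linear_combination oddEuler * E * oddEuler.expand 3 three_ne_zero *
    E.expand 3 three_ne_zero * schurSeries_mul_oddEuler

end SchurSeries

section ThetaDissection

open PowerSeries

theorem isSquare_four_mul_iff {n : ℕ} : IsSquare (4 * n) ↔ IsSquare n := by
  refine ⟨?_, fun h ↦ (IsSquare.sq 2).mul h⟩
  rintro ⟨r, hr⟩
  obtain ⟨s, rfl⟩ : 2 ∣ r := by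
    have h : 2 ∣ r * r := ⟨2 * n, by omega⟩
    simpa [Nat.prime_two.dvd_mul] using h
  exact ⟨s, by nlinarith⟩

theorem mod_eight_eq_one_of_isSquare {n : ℕ} (h : IsSquare n) (hn : ¬ 4 ∣ n) : n % 8 = 1 := by
  obtain ⟨r, rfl⟩ := h
  have hr : Odd r := by
    rw [← Nat.not_even_iff_odd, even_iff_two_dvd]
    exact fun h2 ↦ hn (mul_dvd_mul h2 h2)
  have h8 := Nat.eight_dvd_sq_sub_one_of_odd hr
  have hpos : 0 < r ^ 2 := pow_pos hr.pos 2
  rw [← sq]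
  omega

theorem squareSeries_eq_add : squareSeries =
    squareSeries.expand 4 four_ne_zero + X * thetaPsi.expand 8 (by norm_num) := by
  ext n
  rcases n with _ | n
  · simp [squareSeries]
  have hψ (k : ℕ) : coeff k thetaPsi = if IsSquare (8 * k + 1) then 1 else 0 := coeff_mk _ _
  rw [map_add, coeff_succ_X_mul]
  by_cases h4 : 4 ∣ n + 1
  · obtain ⟨t, ht⟩ := h4
    have ht0 : t ≠ 0 := by omega
    rw [coeff_expand_of_not_dvd 8 _ _ (by omega), ht, coeff_expand_mul, coeff_squareSeries,
      coeff_squareSeries, add_zero]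
    simp [ht0, isSquare_four_mul_iff]
  · rw [coeff_expand_of_not_dvd 4 _ _ h4, zero_add, coeff_squareSeries]
    by_cases h8 : 8 ∣ n
    · obtain ⟨k, rfl⟩ := h8
      rw [coeff_expand_mul, hψ]
      simp
    · rw [coeff_expand_of_not_dvd 8 _ _ h8, if_neg]
      rintro ⟨-, hsq⟩
      have := mod_eight_eq_one_of_isSquare hsq h4
      omega

theorem thetaPhi_eq_add : thetaPhi =
    thetaPhi.expand 4 four_ne_zero + 2 * (X * thetaPsi.expand 8 (by norm_num)) := by
  rw [thetaPhi, map_add, map_one, map_mul, map_ofNat]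
  linear_combination 2 * squareSeries_eq_add

theorem thetaPhiNeg_eq_sub : thetaPhiNeg =
    thetaPhi.expand 4 four_ne_zero - 2 * (X * thetaPsi.expand 8 (by norm_num)) := by
  conv_lhs => rw [thetaPhiNeg, thetaPhi_eq_add]
  rw [map_add, map_mul, map_mul, map_ofNat, evalNegHom_X, evalNegHom_expand _ (by decide),
    evalNegHom_expand _ (by decide)]
  ring

theorem thetaPhiNeg_sq : thetaPhiNeg ^ 2 = (thetaPhi ^ 2).expand 2 two_ne_zero -
    4 * (X * (thetaPsi ^ 2).expand 4 four_ne_zero) := by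
  apply expand_injective two_ne_zero
  rw [map_pow, ← thetaPhi_mul_thetaPhiNeg, thetaPhiNeg_eq_sub]
  nth_rw 1 [thetaPhi_eq_add]
  simp only [map_sub, map_mul, map_pow, map_ofNat, expand_X, expand_eight, expand_four]
  ring

theorem thetaPhi_sq : thetaPhi ^ 2 = (thetaPhi ^ 2).expand 2 two_ne_zero +
    4 * (X * (thetaPsi ^ 2).expand 4 four_ne_zero) := by
  conv_lhs => rw [← evalNegHom_thetaPhiNeg, ← map_pow, thetaPhiNeg_sq]
  rw [map_sub, map_mul, map_mul, map_ofNat, evalNegHom_X, evalNegHom_expand _ even_two,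
    evalNegHom_expand _ (by decide)]
  ring

theorem thetaPsi_sq : thetaPsi ^ 2 = thetaPhi * thetaPsi.expand 2 two_ne_zero := by
  have hX : (4 * X : ℤ⟦X⟧) ≠ 0 := 
    mul_ne_zero (map_ne_zero_iff (C : ℤ →+* ℤ⟦X⟧) C_injective |>.2 four_ne_zero) X_ne_zero
  apply expand_injective four_ne_zero
  refine mul_left_cancel₀ hX ?_
  have hφ := thetaPhi_eq_add
  have hsq := thetaPhi_sq
  have hsq₂ := congrArg (expand 2 two_ne_zero) hsq
  simp only [map_add, map_mul, map_pow, map_ofNat, expand_X, expand_eight, expand_four]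
    at hφ hsq hsq₂ ⊢
  linear_combination (thetaPhi + (thetaPhi.expand 2 two_ne_zero).expand 2 two_ne_zero +
    2 * (X * ((thetaPsi.expand 2 two_ne_zero).expand 2 two_ne_zero).expand 2 two_ne_zero)) * hφ -
    hsq₂ - hsq

theorem constantCoeff_pentagonalSeries : constantCoeff (pentagonalSeries ℤ) = 1 := by
  rw [← coeff_zero_eq_constantCoeff_apply]
  exact (coeff_pentagonalSeries_pentagonal ℤ 0).trans (by simp)

theorem thetaPhiNeg_sq_mul_thetaPsi : thetaPhiNeg ^ 2 * thetaPsi = pentagonalSeries ℤ ^ 3 := by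
  refine eq_of_sq_mul_expand_eq two_ne_zero ?_ ?_ ?_
  · rw [map_mul, map_pow, constantCoeff_thetaPhiNeg, constantCoeff_thetaPsi, one_pow, one_mul]
  · rw [map_pow, constantCoeff_pentagonalSeries, one_pow]
  · have hcube : (pentagonalSeries ℤ ^ 3) ^ 2 =
        (thetaPhiNeg * (pentagonalSeries ℤ).expand 2 two_ne_zero) ^ 3 := by
      rw [thetaPhiNeg_mul_pentagonalSeries]
      ring
    rw [map_mul, map_pow, map_pow, ← thetaPhi_mul_thetaPhiNeg, mul_pow, thetaPsi_sq, hcube]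
    ring

theorem thetaPsi_sq_mul_thetaPhiNeg :
    thetaPsi ^ 2 * thetaPhiNeg = (pentagonalSeries ℤ).expand 2 two_ne_zero ^ 3 := by
  rw [← map_pow, ← thetaPhiNeg_sq_mul_thetaPsi, map_mul, map_pow, ← thetaPhi_mul_thetaPhiNeg,
    thetaPsi_sq]
  ring

end ThetaDissection

section ModThree

open PowerSeries

theorem dissect_two_zero_thetaPhiNeg_sq : dissect 2 0 (thetaPhiNeg ^ 2) = thetaPhi ^ 2 := by
  have h : thetaPhiNeg ^ 2 = (thetaPhi ^ 2).expand 2 two_ne_zero +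
      X * (-4 * (thetaPsi ^ 2).expand 2 two_ne_zero).expand 2 two_ne_zero := by
    rw [thetaPhiNeg_sq, expand_four, map_mul, map_neg, map_ofNat]
    ring
  rw [h, dissect_two_zero]

theorem dissect_two_one_thetaPhi_pow_four :
    dissect 2 1 (thetaPhi ^ 4) = 8 * thetaPhi ^ 2 * (thetaPsi ^ 2).expand 2 two_ne_zero := by
  have h : thetaPhi ^ 4 =
      (thetaPhi ^ 4 + 16 * X * (thetaPsi ^ 4).expand 2 two_ne_zero).expand 2 two_ne_zero +
      X * (8 * thetaPhi ^ 2 * (thetaPsi ^ 2).expand 2 two_ne_zero).expand 2 two_ne_zero := by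
    have hsq := thetaPhi_sq
    simp only [expand_four, map_add, map_mul, map_pow, map_ofNat, expand_X] at hsq ⊢
    linear_combination (thetaPhi ^ 2 + (thetaPhi.expand 2 two_ne_zero) ^ 2 +
      4 * (X * (thetaPsi.expand 2 two_ne_zero).expand 2 two_ne_zero ^ 2)) * hsq
  conv_lhs => rw [h]
  rw [dissect_two_one]

theorem dissect_two_zero_thetaPhi_sq : dissect 2 0 (thetaPhi ^ 2) = thetaPhi ^ 2 := by
  have h : thetaPhi ^ 2 = (thetaPhi ^ 2).expand 2 two_ne_zero +
      X * (4 * (thetaPsi ^ 2).expand 2 two_ne_zero).expand 2 two_ne_zero := by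
    conv_lhs => rw [thetaPhi_sq]
    rw [expand_four, map_mul _ 4, map_ofNat]
    ring
  conv_lhs => rw [h]
  rw [dissect_two_zero]

/-- Reduction modulo `3` of the coefficients of an integral power series. -/
noncomputable def modThree : ℤ⟦X⟧ →+* (ZMod 3)⟦X⟧ := map (Int.castRingHom (ZMod 3))

theorem modThree_expand {k : ℕ} (hk : k ≠ 0) (f : ℤ⟦X⟧) :
    modThree (f.expand k hk) = (modThree f).expand k hk :=
  map_expand k hk _ f

theorem modThree_dissect (m r : ℕ) (f : ℤ⟦X⟧) :
    modThree (dissect m r f) = dissect m r (modThree f) := by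
  ext n
  rw [modThree, coeff_map, coeff_dissect, coeff_dissect, coeff_map]

theorem modThree_thetaPhiNeg_ne_zero : modThree thetaPhiNeg ≠ 0 := by
  intro h
  have h1 := congrArg constantCoeff h
  rw [modThree, ← coeff_zero_eq_constantCoeff_apply, coeff_map,
    coeff_zero_eq_constantCoeff_apply, constantCoeff_thetaPhiNeg, map_one, map_zero] at h1
  exact one_ne_zero h1

theorem modThree_schurSeries_mul :
    modThree schurSeries * (modThree thetaPhiNeg ^ 2).expand 2 two_ne_zero =
      modThree thetaPhiNeg ^ 2 := by
  have h := congrArg modThree schurSeries_mul_thetaPhiNeg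
  simp only [expand_six, map_mul, modThree_expand, ← pow_eq_expand 3] at h
  have hne : (modThree thetaPhiNeg).expand 2 two_ne_zero ≠ 0 :=
    (map_ne_zero_iff _ (expand_injective two_ne_zero)).2 modThree_thetaPhiNeg_ne_zero
  refine mul_right_cancel₀ (mul_ne_zero modThree_thetaPhiNeg_ne_zero hne) ?_
  rw [map_pow]
  linear_combination h

theorem mul_expand_modThree_thetaPhiNeg_pow {F H : (ZMod 3)⟦X⟧} {m : ℕ}
    (h : F * modThree thetaPhiNeg ^ m = H) :
    F * (modThree thetaPhiNeg ^ (2 * m)).expand 2 two_ne_zero = modThree thetaPhi ^ m * H := by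
  rw [map_pow, pow_mul, ← modThree_expand, ← map_pow modThree, ← thetaPhi_mul_thetaPhiNeg,
    map_mul, mul_pow, ← h]
  ring

theorem dissect_two_zero_modThree_schurSeries_mul :
    dissect 2 0 (modThree schurSeries) * modThree thetaPhiNeg ^ 2 = modThree thetaPhi ^ 2 := by
  rw [← dissect_mul_expand two_ne_zero two_pos, modThree_schurSeries_mul, ← map_pow,
    ← modThree_dissect, dissect_two_zero_thetaPhiNeg_sq, map_pow]

theorem dissect_four_two_modThree_schurSeries_mul :
    dissect 4 2 (modThree schurSeries) * modThree thetaPhiNeg ^ 4 =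
      modThree (8 * thetaPhi ^ 2 * (thetaPsi ^ 2).expand 2 two_ne_zero) := by
  have h := mul_expand_modThree_thetaPhiNeg_pow dissect_two_zero_modThree_schurSeries_mul
  rw [← pow_add, ← map_pow modThree thetaPhi] at h
  rw [← dissect_two_one_thetaPhi_pow_four, modThree_dissect, ← h,
    dissect_mul_expand two_ne_zero one_lt_two, dissect_dissect]
  rfl

theorem dissect_eight_two_modThree_schurSeries_mul :
    dissect 8 2 (modThree schurSeries) * modThree thetaPhiNeg ^ 8 =
      modThree (8 * thetaPhi ^ 6 * thetaPsi ^ 2) := by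
  have h := congrArg (dissect 2 0)
    (mul_expand_modThree_thetaPhiNeg_pow dissect_four_two_modThree_schurSeries_mul)
  have hsix : dissect 2 0 (modThree thetaPhi ^ 6) = modThree thetaPhi ^ 6 := by
    rw [show 6 = 2 * 3 from rfl, pow_mul, pow_eq_expand 3, dissect_zero_expand _ (by norm_num),
      ← map_pow, ← modThree_dissect, dissect_two_zero_thetaPhi_sq]
  have hfactor : modThree thetaPhi ^ 4 *
      modThree (8 * thetaPhi ^ 2 * (thetaPsi ^ 2).expand 2 two_ne_zero) =
        modThree thetaPhi ^ 6 * (8 * modThree thetaPsi ^ 2).expand 2 two_ne_zero := by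
    simp only [map_mul, map_pow, map_ofNat, modThree_expand]
    ring
  rw [hfactor, dissect_mul_expand _ two_pos, dissect_mul_expand _ two_pos, hsix,
    dissect_dissect] at h
  refine h.trans ?_
  simp only [map_mul, map_pow, map_ofNat]
  ring

theorem three_dvd_schurOverpartitionCount {n : ℕ} (hn : ¬ 3 ∣ n) :
    3 ∣ schurOverpartitionCount 3 (8 * n + 2) := by
  have hcube : dissect 8 2 (modThree schurSeries) *
      (modThree thetaPhiNeg ^ 3).expand 3 three_ne_zero =
        (modThree (2 * thetaPhi ^ 2 * (pentagonalSeries ℤ).expand 2 two_ne_zero)).expand 3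
          three_ne_zero := by
    have h := dissect_eight_two_modThree_schurSeries_mul
    have hψ := congrArg modThree thetaPsi_sq_mul_thetaPhiNeg
    simp only [map_mul, map_pow, map_ofNat, ← pow_eq_expand 3] at h hψ ⊢
    linear_combination modThree thetaPhiNeg * h + 8 * modThree thetaPhi ^ 6 * hψ
  have h := coeff_eq_zero_of_mul_expand_eq_expand three_ne_zero
    (pow_ne_zero 3 modThree_thetaPhiNeg_ne_zero) hcube hn
  rw [coeff_dissect, modThree, coeff_map, schurSeries, coeff_mk, eq_intCast, Int.cast_natCast,
    ZMod.natCast_eq_zero_iff] at h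
  exact h

end ModThree

section ModEight

open PowerSeries Finset

theorem eq_of_mul_one_add_two_mul {R : Type*} [CommRing R] (h8 : (8 : R) = 0) {s a b c d : R}
    (h : s * (1 + 2 * a) * (1 + 2 * d) = (1 + 2 * b) * (1 + 2 * c)) :
    s = 1 + 2 * (b + c - a - d) +
      4 * (a ^ 2 + d ^ 2 + a * d + b * c - (a + d) * (b + c)) := by
  have hinv (x : R) : (1 + 2 * x) * (1 - 2 * x + 4 * x ^ 2) = 1 := by
    linear_combination x ^ 3 * h8
  have hmul (x y z w : R) : (1 + 2 * x + 4 * y) * (1 + 2 * z + 4 * w) =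
      1 + 2 * (x + z) + 4 * (y + w + x * z) := by
    linear_combination (x * w + y * z + 2 * y * w) * h8
  calc s = s * ((1 + 2 * a) * (1 - 2 * a + 4 * a ^ 2)) *
        ((1 + 2 * d) * (1 - 2 * d + 4 * d ^ 2)) := by rw [hinv, hinv, mul_one, mul_one]
    _ = (1 + 2 * (b + c) + 4 * (b * c)) *
        ((1 + 2 * -a + 4 * a ^ 2) * (1 + 2 * -d + 4 * d ^ 2)) := by
      linear_combination (1 - 2 * a + 4 * a ^ 2) * (1 - 2 * d + 4 * d ^ 2) * h
    _ = _ := by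
      rw [hmul, hmul]
      ring

theorem four_mul_sq_eq_four_mul_expand (f : (ZMod 8)⟦X⟧) :
    4 * f ^ 2 = 4 * f.expand 2 two_ne_zero := by
  have hcast : ∀ a : ZMod 8, ZMod.castHom (by norm_num : 2 ∣ 8) (ZMod 2) a = 0 → 4 * a = 0 := by
    decide
  have hmod : map (ZMod.castHom (by norm_num : 2 ∣ 8) (ZMod 2))
      (f ^ 2 - f.expand 2 two_ne_zero) = 0 := by
    rw [map_sub, map_pow, map_expand, pow_eq_expand, sub_self]
  rw [← sub_eq_zero, ← mul_sub]
  ext n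
  have hn := congrArg (coeff n) hmod
  rw [coeff_map, map_zero] at hn
  rw [← map_ofNat C, coeff_C_mul, hcast _ hn, map_zero]

/-- The series `∑ (-1) ^ x * q ^ (k * x ^ 2)` over the positive integers `x`, with coefficients
reduced modulo `8`. -/
noncomputable def signedSquareSeries (k : ℕ) [NeZero k] : (ZMod 8)⟦X⟧ :=
  (map (Int.castRingHom (ZMod 8)) (evalNegHom squareSeries)).expand k (NeZero.ne k)

section Support

variable {i j N : ℕ} [NeZero i] [NeZero j]

theorem coeff_signedSquareSeries_eq_zero (h : ∀ x, i * x ^ 2 ≠ N) :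
    coeff N (signedSquareSeries i) = 0 := by
  rw [signedSquareSeries, coeff_expand]
  split_ifs with hd
  · rw [coeff_map, evalNegHom, coeff_rescale, coeff_squareSeries, if_neg, mul_zero, map_zero]
    rintro ⟨-, x, hx⟩
    exact h x (by rw [sq, ← hx, Nat.mul_div_cancel' hd])
  · rfl

theorem coeff_signedSquareSeries_mul_eq_zero (h : ∀ x y, i * x ^ 2 + j * y ^ 2 ≠ N) :
    coeff N (signedSquareSeries i * signedSquareSeries j) = 0 := by
  rw [coeff_mul]
  refine sum_eq_zero fun uv huv ↦ ?_
  rw [HasAntidiagonal.mem_antidiagonal] at huv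
  by_cases hu : ∃ x, i * x ^ 2 = uv.1
  · obtain ⟨x, hx⟩ := hu
    rw [coeff_signedSquareSeries_eq_zero (i := j) fun y hy ↦ h x y (by rw [hx, hy, huv]), mul_zero]
  · push Not at hu
    rw [coeff_signedSquareSeries_eq_zero hu, zero_mul]

theorem coeff_signedSquareSeries_eq_zero_of_zmod {m : ℕ} {r : ZMod m} (hN : (N : ZMod m) = r)
    (h : ∀ a : ZMod m, i * a ^ 2 ≠ r) : coeff N (signedSquareSeries i) = 0 := by
  refine coeff_signedSquareSeries_eq_zero ?_
  rintro x rfl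
  exact h x (by rw [← hN, Nat.cast_mul, Nat.cast_pow])

theorem coeff_signedSquareSeries_mul_eq_zero_of_zmod {m : ℕ} {r : ZMod m}
    (hN : (N : ZMod m) = r) (h : ∀ a b : ZMod m, i * a ^ 2 + j * b ^ 2 ≠ r) :
    coeff N (signedSquareSeries i * signedSquareSeries j) = 0 := by
  refine coeff_signedSquareSeries_mul_eq_zero ?_
  rintro x y rfl
  exact h x y (by rw [← hN]; push_cast; rfl)

end Support

theorem map_expand_thetaPhiNeg (k : ℕ) [NeZero k] :
    map (Int.castRingHom (ZMod 8)) (thetaPhiNeg.expand k (NeZero.ne k)) =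
      1 + 2 * signedSquareSeries k := by
  simp only [thetaPhiNeg, thetaPhi, signedSquareSeries, map_expand, map_add, map_mul, map_one,
    map_ofNat]

theorem four_mul_signedSquareSeries_sq {k l : ℕ} [NeZero k] [NeZero l] (h : 2 * k = l) :
    4 * signedSquareSeries k ^ 2 = 4 * signedSquareSeries l := by
  subst h
  rw [four_mul_sq_eq_four_mul_expand, signedSquareSeries, signedSquareSeries, expand_mul]

theorem map_schurSeries : map (Int.castRingHom (ZMod 8)) schurSeries =
    1 + 2 * (signedSquareSeries 2 + signedSquareSeries 3 - signedSquareSeries 1 -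
        signedSquareSeries 6) +
      4 * (signedSquareSeries 2 + signedSquareSeries 12 +
        signedSquareSeries 1 * signedSquareSeries 6 + signedSquareSeries 2 * signedSquareSeries 3 -
        (signedSquareSeries 1 + signedSquareSeries 6) *
          (signedSquareSeries 2 + signedSquareSeries 3)) := by
  have h8 : (8 : (ZMod 8)⟦X⟧) = 0 := by
    rw [← map_ofNat C, show (OfNat.ofNat 8 : ZMod 8) = 0 from rfl, map_zero]
  have h := congrArg (map (Int.castRingHom (ZMod 8))) schurSeries_mul_thetaPhiNeg
  have h1 := map_expand_thetaPhiNeg 1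
  rw [expand_one_apply] at h1
  rw [map_mul, map_mul, map_mul, h1, map_expand_thetaPhiNeg 6, map_expand_thetaPhiNeg 2,
    map_expand_thetaPhiNeg 3] at h
  rw [eq_of_mul_one_add_two_mul h8 h]
  linear_combination four_mul_signedSquareSeries_sq (k := 1) (l := 2) rfl +
    four_mul_signedSquareSeries_sq (k := 6) (l := 12) rfl

theorem eight_dvd_schurOverpartitionCount {N : ℕ} (hN : N % 48 = 10)
    (hrep : ∀ x y : ℕ, x ^ 2 + 6 * y ^ 2 ≠ N) : 8 ∣ schurOverpartitionCount 3 N := by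
  have hN16 : (N : ZMod 16) = (10 : ℕ) := (ZMod.natCast_eq_natCast_iff' ..).2 (by omega)
  have hN3 : (N : ZMod 3) = (1 : ℕ) := (ZMod.natCast_eq_natCast_iff' ..).2 (by omega)
  have h1 := coeff_signedSquareSeries_eq_zero_of_zmod (i := 1) hN16 (by decide)
  have h2 := coeff_signedSquareSeries_eq_zero_of_zmod (i := 2) hN16 (by decide)
  have h3 := coeff_signedSquareSeries_eq_zero_of_zmod (i := 3) hN3 (by decide)
  have h6 := coeff_signedSquareSeries_eq_zero_of_zmod (i := 6) hN3 (by decide)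
  have h12 := coeff_signedSquareSeries_eq_zero_of_zmod (i := 12) hN3 (by decide)
  have h1_2 := coeff_signedSquareSeries_mul_eq_zero_of_zmod (i := 1) (j := 2) hN16 (by decide)
  have h1_3 := coeff_signedSquareSeries_mul_eq_zero_of_zmod (i := 1) (j := 3) hN16 (by decide)
  have h2_3 := coeff_signedSquareSeries_mul_eq_zero_of_zmod (i := 2) (j := 3) hN16 (by decide)
  have h6_2 := coeff_signedSquareSeries_mul_eq_zero_of_zmod (i := 6) (j := 2) hN3 (by decide)
  have h6_3 := coeff_signedSquareSeries_mul_eq_zero_of_zmod (i := 6) (j := 3) hN3 (by decide)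
  have h1_6 : coeff N (signedSquareSeries 1 * signedSquareSeries 6) = 0 :=
    coeff_signedSquareSeries_mul_eq_zero (by simpa only [one_mul] using hrep)
  have hN0 : N ≠ 0 := by omega
  have hcoeff : coeff N (map (Int.castRingHom (ZMod 8)) schurSeries) = 0 := by
    simp only [map_schurSeries, add_mul, mul_add, mul_sub, ← map_ofNat C, map_add, map_sub,
      coeff_C_mul, coeff_one, if_neg hN0, h1, h2, h3, h6, h12, h1_2, h1_3, h1_6, h2_3, h6_2, h6_3,
      mul_zero, add_zero, sub_zero]
  rwa [coeff_map, schurSeries, coeff_mk, eq_intCast, Int.cast_natCast,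
    ZMod.natCast_eq_zero_iff] at hcoeff

end ModEight

theorem sq_sub_mul_sq_ne {p : ℕ} [Fact p.Prime] {a v : ℤ} (ha : legendreSym p a = -1)
    (hv : ¬ (p : ℤ) ∣ v) (α : ℕ) (x y : ℤ) : x ^ 2 - a * y ^ 2 ≠ p ^ (2 * α + 1) * v := by
  have hp : (p : ℤ) ≠ 0 := mod_cast (Fact.out : p.Prime).ne_zero
  induction α generalizing x y with
  | zero =>
    intro h
    obtain ⟨⟨x, rfl⟩, y, rfl⟩ := legendreSym.prime_dvd_of_eq_neg_one ha (x := x) (y := y)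
      ⟨v, by linear_combination h⟩
    exact hv ⟨x ^ 2 - a * y ^ 2, mul_left_cancel₀ hp (by linear_combination -h)⟩
  | succ α ih =>
    intro h
    obtain ⟨⟨x, rfl⟩, y, rfl⟩ := legendreSym.prime_dvd_of_eq_neg_one ha (x := x) (y := y)
      ⟨p ^ (2 * α + 2) * v, by linear_combination h⟩
    exact ih x y (mul_left_cancel₀ (pow_ne_zero 2 hp) (by linear_combination h))

theorem twenty_four_dvd_schurOverpartitionCount {N : ℕ} (hN : N % 48 = 10)
    (hrep : ∀ x y : ℕ, x ^ 2 + 6 * y ^ 2 ≠ N) : 24 ∣ schurOverpartitionCount 3 N := by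
  have h3 : 3 ∣ schurOverpartitionCount 3 (8 * (N / 8) + 2) :=
    three_dvd_schurOverpartitionCount (by omega)
  have h8 := eight_dvd_schurOverpartitionCount hN hrep
  rw [show 8 * (N / 8) + 2 = N by omega] at h3
  omega

theorem sq_mod_twenty_four {m : ℕ} (hm : m.Coprime 24) : m ^ 2 % 24 = 1 := by
  have hunits : ∀ u : (ZMod 24)ˣ, u ^ 2 = 1 := by decide
  have h := congrArg Units.val (hunits (ZMod.unitOfCoprime m hm))
  rw [Units.val_pow_eq_pow_val, ZMod.coe_unitOfCoprime, Units.val_one] at h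
  exact (ZMod.natCast_eq_natCast_iff' _ _ _).1 (by exact_mod_cast h)

theorem coprime_forty_eight {p : ℕ} (hp : p.Prime) (h5 : 5 ≤ p) : p.Coprime 48 := by
  rw [show 48 = 2 ^ 4 * 3 from rfl]
  exact (((Nat.coprime_primes hp Nat.prime_two).2 (by omega)).pow_right 4).mul_right
    ((Nat.coprime_primes hp Nat.prime_three).2 (by omega))

theorem theorem4p7 (p : ℕ) [Fact p.Prime] (hp : 5 ≤ p) (hleg : legendreSym p (-6) = -1)
    (i : ℕ) (hi₁ : 1 ≤ i) (hi₂ : i ≤ p - 1) (α n : ℕ) :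
    schurOverpartitionCount 3
      (48 * p ^ (2 * α + 2) * n + 2 * (24 * i + 5 * p) * p ^ (2 * α + 1)) ≡ 0 [MOD 24] := by
  have hprime : p.Prime := Fact.out
  have hcop : p.Coprime 48 := coprime_forty_eight hprime hp
  have hsq : (p ^ (α + 1)) ^ 2 % 24 = 1 :=
    sq_mod_twenty_four ((hcop.coprime_dvd_right (by norm_num)).pow_left _)
  have hmod : 48 * p ^ (2 * α + 2) * n + 2 * (24 * i + 5 * p) * p ^ (2 * α + 1) =
      48 * (p ^ (2 * α + 2) * n + i * p ^ (2 * α + 1)) + 10 * (p ^ (α + 1)) ^ 2 := by ring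
  have hv : ¬ (p : ℤ) ∣ p * (48 * n + 10) + 48 * i := by
    rw [dvd_add_right (dvd_mul_right _ _)]
    norm_cast
    rw [hcop.dvd_mul_left]
    exact Nat.not_dvd_of_pos_of_lt hi₁ (by omega)
  refine Nat.modEq_zero_iff_dvd.2 (twenty_four_dvd_schurOverpartitionCount ?_ fun x y hxy ↦ ?_)
  · omega
  · refine sq_sub_mul_sq_ne hleg hv α x y ?_
    zify at hxy
    linear_combination hxy
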